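/- Let $\mathcal A$ be a Desargues affine plane, that is: a set $\mathcal P$ of points with a family $\mathcal L$ of subsets of $\mathcal P$, called lines, such that two distinct points lie on exactly one line; through a point off a line $\ell$ there is exactly one line disjoint from $\ell$; there are three non-collinear points; and Desargues' axiom holds, both for triangles perspective along three parallel lines and for triangles perspective from a point. Write $\ell^{XY}$ for the line through distinct points $X,Y$, and call two lines parallel if they are equal or disjoint. For distinct points $O,I$, the product $A\cdot B$ of $A,B\in\ell^{OI}$ is the point of $\ell^{OI}$ constructed as follows: choose a point $B_1\notin\ell^{OI}$, let $P_1$ be the intersection of $\ell^{OB_1}$ with the parallel to $\ell^{IB_1}$ through $A$, and let $A\cdot B$ be the intersection of $\ell^{OI}$ with the parallel to $\ell^{BB_1}$ through $P_1$. For $B\in\ell^{OI}$ with $B\ne O$, $B^{-1}$ denotes the point of $\ell^{OI}$ with $B\cdot B^{-1}=B^{-1}\cdot B=I$, and for $A\in\ell^{OI}$ the ratio of $A$ and $B$ is $r(A:B)=B^{-1}\cdot A$. A dilatation of $\mathcal A$ is a bijection of $\mathcal P$ under which lines correspond to lines and every line is mapped to a parallel line; a translation is the identity or a dilatation without fixed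 points. Theorem. Let $\varphi$ be a translation of a Desargues affine plane, let $O\neq I$ be points, and let $A,B\in\ell^{OI}$ with $B\ne O$. Then the points $B^{-1}$ and $r(A:B)$ are well defined (they exist, are unique, and in particular the constructions do not depend on the auxiliary points), and $$\varphi(B^{-1})=\varphi(B)^{-1},\qquad \varphi\big(r(A:B)\big)=r\big(\varphi(A):\varphi(B)\big),$$ where the inverse and the ratio on the right-hand sides are formed on the line $\ell^{O'I'}$ with zero point $O'=\varphi(O)$ and unit point $I'=\varphi(I)$. This includes the case $\varphi(\ell^{OI})=\ell^{OI}$, where $O',I'$ are still $\varphi(O),\varphi(I)$. -/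

import Mathlib

/-- An affine plane: a set of points `P` with a family of lines (sets of points). -/
structure AffinePlane (P : Type*) where
  /-- The lines of the plane. -/
  Lines : Set (Set P)
  /-- Two distinct points lie on exactly one line. -/
  existsUnique_line : ∀ X Y : P, X ≠ Y → ∃! l : Set P, l ∈ Lines ∧ X ∈ l ∧ Y ∈ l
  /-- Playfair's parallel axiom. -/
  playfair : ∀ (X : P) (l : Set P), l ∈ Lines → X ∉ l →
    ∃! m : Set P, m ∈ Lines ∧ X ∈ m ∧ l ∩ m = ∅
  /-- There are three non-collinear points. -/
  exists_noncollinear : ∃ X Y Z : P, X ≠ Y ∧ Y ≠ Z ∧ X ≠ Z ∧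
    ∀ l ∈ Lines, ¬ (X ∈ l ∧ Y ∈ l ∧ Z ∈ l)

namespace AffinePlane

/-- Parallelism of lines: equal or disjoint. -/
def Parallel {P : Type*} (l m : Set P) : Prop := l = m ∨ l ∩ m = ∅

variable {P : Type*} (𝒜 : AffinePlane P)

/-- The line through `X` and `Y`; only meaningful (and only used) for `X ≠ Y`. -/
def line (X Y : P) : Set P := {Z | ∃ l ∈ 𝒜.Lines, X ∈ l ∧ Y ∈ l ∧ Z ∈ l}

/-- The line through `X` parallel to the line `l`. -/
def parallelThrough (X : P) (l : Set P) : Set P :=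
  {Z | ∃ m ∈ 𝒜.Lines, X ∈ m ∧ Parallel m l ∧ Z ∈ m}

/-- Desargues' axiom, for three parallel lines and for three concurrent lines
`AA'`, `BB'`, `CC'`. -/
def Desargues : Prop :=
  ∀ A B C A' B' C' : P,
    A ≠ A' → B ≠ B' → C ≠ C' →
    A ≠ B → A' ≠ B' → B ≠ C → B' ≠ C' → A ≠ C → A' ≠ C' →
    [𝒜.line A A', 𝒜.line B B', 𝒜.line C C', 𝒜.line A C, 𝒜.line A' C'].Nodup →
    𝒜.line A B ≠ 𝒜.line A' B' → 𝒜.line B C ≠ 𝒜.line B' C' →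
    ((Parallel (𝒜.line A A') (𝒜.line B B') ∧ Parallel (𝒜.line B B') (𝒜.line C C')) ∨
      ∃ V : P, 𝒜.line A A' ∩ 𝒜.line B B' ∩ 𝒜.line C C' = {V}) →
    Parallel (𝒜.line A B) (𝒜.line A' B') →
    Parallel (𝒜.line B C) (𝒜.line B' C') →
    Parallel (𝒜.line A C) (𝒜.line A' C')

/-- `C` is obtained from `A`, `B` by the geometric multiplication on the line `OI`: choose an
auxiliary point `B₁` off `OI`; the parallel to `I B₁` through `A` meets `O B₁` in `P₁`; the
parallel to `B B₁` through `P₁` meets `OI` in `C`. -/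
def IsProduct (O I A B C : P) : Prop :=
  ∃ B₁ P₁ : P, B₁ ∉ 𝒜.line O I ∧
    𝒜.parallelThrough A (𝒜.line I B₁) ∩ 𝒜.line O B₁ = {P₁} ∧
    𝒜.parallelThrough P₁ (𝒜.line B B₁) ∩ 𝒜.line O I = {C}

/-- `S` is the two-sided inverse of `B` for the multiplication on the line `OI` with unit `I`. -/
def IsInverse (O I B S : P) : Prop :=
  S ∈ 𝒜.line O I ∧ 𝒜.IsProduct O I B S I ∧ 𝒜.IsProduct O I S B I

/-- The product `A · B` on the line `OI` (zero `O`, unit `I`). -/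
noncomputable def mul (O I A B : P) : P :=
  @Classical.epsilon P ⟨O⟩ (fun C => 𝒜.IsProduct O I A B C)

/-- The inverse `B⁻¹` on the line `OI` (zero `O`, unit `I`), meaningful for `B ≠ O`. -/
noncomputable def inv (O I B : P) : P :=
  @Classical.epsilon P ⟨O⟩ (fun S => 𝒜.IsInverse O I B S)

/-- The ratio `r(A : B) = B⁻¹ · A` of two points of the line `OI`, meaningful for `B ≠ O`. -/
noncomputable def ratio (O I A B : P) : P := 𝒜.mul O I (𝒜.inv O I B) A

/-- A collineation: a bijection of the points under which lines correspond to lines. -/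
def IsCollineation (f : Equiv.Perm P) : Prop :=
  ∀ l : Set P, l ∈ 𝒜.Lines ↔ f '' l ∈ 𝒜.Lines

/-- A dilatation: a collineation mapping every line to a parallel line. -/
def IsDilatation (f : Equiv.Perm P) : Prop :=
  𝒜.IsCollineation f ∧ ∀ X Y : P, X ≠ Y → Parallel (f '' 𝒜.line X Y) (𝒜.line X Y)

/-- A translation: the identity, or a dilatation without fixed points. -/
def IsTranslation (f : Equiv.Perm P) : Prop :=
  f = 1 ∨ (𝒜.IsDilatation f ∧ ∀ X : P, f X ≠ X)

end AffinePlane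

/-!
The whole theorem rests on one fact: the point `A · B` does not depend on the auxiliary point `B₁`
used to construct it (`AffinePlane.ProductVia.result_eq`). If `B₁` and `B₂` are auxiliary points
lying on different lines through `O`, with first-step points `P₁` and `P₂`, Desargues' axiom with
centre `O` applied to the triangles `B₁ I B₂` and `P₁ A P₂` gives `B₁B₂ ∥ P₁P₂`; a second
application, to `B B₁ B₂` and `C P₁ P₂`, gives `BB₂ ∥ CP₂`, which says that `B₂` yields the same
product `C`. If `B₁` and `B₂` are on the same line through `O`, one passes through a third auxiliary
point on another line.

For the inverse, no further use of Desargues' axiom is needed. The figure that exhibits `B · S = I`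
with auxiliary point `B₁` and first-step point `P₁` consists of `IB₁ ∥ BP₁` and `SB₁ ∥ IP₁`; read
with `P₁` as auxiliary point and `B₁` as first-step point, the same figure exhibits `S · B = I`
(`AffinePlane.ProductVia.swap`). Hence a right inverse is two-sided, and for a fixed `B₁` it is
determined by the line through `B₁` parallel to `IP₁`.

A collineation carries the figure of a product to the figure of a product. The compatibility of a
translation with inverses and ratios therefore follows from their uniqueness.
-/

namespace AffinePlane

/-! ### Incidence and parallelism -/

theorem Parallel.symm {P : Type*} {l m : Set P} (h : Parallel l m) : Parallel m l :=
  h.imp Eq.symm fun h => by rwa [Set.inter_comm]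

theorem Parallel.refl {P : Type*} (l : Set P) : Parallel l l := Or.inl rfl

theorem Parallel.eq_of_mem {P : Type*} {l m : Set P} (h : Parallel l m) {X : P} (hl : X ∈ l)
    (hm : X ∈ m) : l = m :=
  h.resolve_right fun h => (h ▸ Set.mem_inter hl hm : X ∈ (∅ : Set P))

variable {P : Type*} {𝒜 : AffinePlane P}

theorem eq_of_mem_of_mem {l m : Set P} (hl : l ∈ 𝒜.Lines) (hm : m ∈ 𝒜.Lines) {X Y : P}
    (hXY : X ≠ Y) (hXl : X ∈ l) (hYl : Y ∈ l) (hXm : X ∈ m) (hYm : Y ∈ m) : l = m :=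
  (𝒜.existsUnique_line X Y hXY).unique ⟨hl, hXl, hYl⟩ ⟨hm, hXm, hYm⟩

theorem line_eq {l : Set P} (hl : l ∈ 𝒜.Lines) {X Y : P} (hXY : X ≠ Y) (hX : X ∈ l)
    (hY : Y ∈ l) : 𝒜.line X Y = l := by
  ext Z
  constructor
  · rintro ⟨m, hm, hXm, hYm, hZ⟩
    rwa [eq_of_mem_of_mem hl hm hXY hX hY hXm hYm]
  · exact fun hZ => ⟨l, hl, hX, hY, hZ⟩

theorem line_mem_Lines {X Y : P} (hXY : X ≠ Y) : 𝒜.line X Y ∈ 𝒜.Lines := by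
  obtain ⟨l, hl, hX, hY⟩ := (𝒜.existsUnique_line X Y hXY).exists
  rwa [line_eq hl hXY hX hY]

theorem left_mem_line {X Y : P} (hXY : X ≠ Y) : X ∈ 𝒜.line X Y := by
  obtain ⟨l, hl, hX, hY⟩ := (𝒜.existsUnique_line X Y hXY).exists
  rwa [line_eq hl hXY hX hY]

theorem right_mem_line {X Y : P} (hXY : X ≠ Y) : Y ∈ 𝒜.line X Y := by
  obtain ⟨l, hl, hX, hY⟩ := (𝒜.existsUnique_line X Y hXY).exists
  rwa [line_eq hl hXY hX hY]

theorem line_comm (X Y : P) : 𝒜.line X Y = 𝒜.line Y X := by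
  ext Z
  simp only [line, Set.mem_ofPred_eq, and_left_comm (a := X ∈ _)]

theorem Parallel.trans {l m n : Set P} (hl : l ∈ 𝒜.Lines) (hm : m ∈ 𝒜.Lines) (hn : n ∈ 𝒜.Lines)
    (hlm : Parallel l m) (hmn : Parallel m n) : Parallel l n := by
  by_contra h
  obtain ⟨X, hXl, hXn⟩ : (l ∩ n).Nonempty :=
    Set.nonempty_iff_ne_empty.2 fun h' => h (Or.inr h')
  by_cases hX : X ∈ m
  · exact h (Or.inl ((hlm.eq_of_mem hXl hX).trans (hmn.eq_of_mem hX hXn)))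
  · have h1 : m ∩ l = ∅ := hlm.symm.resolve_left fun e => hX (e ▸ hXl)
    have h2 : m ∩ n = ∅ := hmn.resolve_left fun e => hX (e ▸ hXn)
    exact h (Or.inl ((𝒜.playfair X m hm hX).unique ⟨hl, hXl, h1⟩ ⟨hn, hXn, h2⟩))

theorem exists_parallel (X : P) {l : Set P} (hl : l ∈ 𝒜.Lines) :
    ∃ m ∈ 𝒜.Lines, X ∈ m ∧ Parallel m l := by
  by_cases hX : X ∈ l
  · exact ⟨l, hl, hX, .refl l⟩
  · obtain ⟨m, hm, hXm, h⟩ := (𝒜.playfair X l hl hX).exists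
    exact ⟨m, hm, hXm, Parallel.symm (Or.inr h)⟩

theorem parallelThrough_eq {X : P} {l m : Set P} (hl : l ∈ 𝒜.Lines) (hm : m ∈ 𝒜.Lines)
    (hX : X ∈ m) (h : Parallel m l) : 𝒜.parallelThrough X l = m := by
  ext Z
  constructor
  · rintro ⟨n, hn, hXn, hnl, hZ⟩
    rwa [(hnl.trans hn hl hm h.symm).eq_of_mem hXn hX] at hZ
  · exact fun hZ => ⟨m, hm, hX, h, hZ⟩

theorem parallelThrough_spec (X : P) {l : Set P} (hl : l ∈ 𝒜.Lines) :
    𝒜.parallelThrough X l ∈ 𝒜.Lines ∧ X ∈ 𝒜.parallelThrough X l ∧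
      Parallel (𝒜.parallelThrough X l) l := by
  obtain ⟨m, hm, hX, h⟩ := exists_parallel X hl
  rw [parallelThrough_eq hl hm hX h]
  exact ⟨hm, hX, h⟩

theorem mem_parallelThrough_comm {X Y : P} {l : Set P} :
    Y ∈ 𝒜.parallelThrough X l ↔ X ∈ 𝒜.parallelThrough Y l := by
  constructor <;> exact fun ⟨m, hm, h1, h, h2⟩ => ⟨m, hm, h2, h, h1⟩

theorem mem_parallelThrough_iff {X Y : P} {l : Set P} (hXY : X ≠ Y) :
    Y ∈ 𝒜.parallelThrough X l ↔ Parallel (𝒜.line X Y) l := by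
  constructor
  · rintro ⟨m, hm, hX, h, hY⟩
    rwa [line_eq hm hXY hX hY]
  · exact fun h => ⟨_, line_mem_Lines hXY, left_mem_line hXY, h, right_mem_line hXY⟩

theorem inter_eq_singleton {l m : Set P} (hl : l ∈ 𝒜.Lines) (hm : m ∈ 𝒜.Lines) (h : l ≠ m)
    {X : P} (hXl : X ∈ l) (hXm : X ∈ m) : l ∩ m = {X} := by
  ext Y
  constructor
  · rintro ⟨hYl, hYm⟩
    by_contra hY
    exact h (eq_of_mem_of_mem hl hm hY hYl hXl hYm hXm)
  · rintro rfl
    exact ⟨hXl, hXm⟩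

/-- If `l` and `m` are distinct lines through a common point, then every parallel to `l` meets `m`
in exactly one point. -/
theorem exists_parallelThrough_inter {l m : Set P} (hl : l ∈ 𝒜.Lines) (hm : m ∈ 𝒜.Lines)
    (h : l ≠ m) {Y : P} (hYl : Y ∈ l) (hYm : Y ∈ m) (X : P) :
    ∃ Z, 𝒜.parallelThrough X l ∩ m = {Z} := by
  obtain ⟨hn, -, hnl⟩ := parallelThrough_spec X hl
  have hne : ¬ Parallel (𝒜.parallelThrough X l) m := fun h' =>
    h ((hnl.symm.trans hl hn hm h').eq_of_mem hYl hYm)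
  obtain ⟨Z, hZ, hZm⟩ : (𝒜.parallelThrough X l ∩ m).Nonempty :=
    Set.nonempty_iff_ne_empty.2 fun h' => hne (Or.inr h')
  exact ⟨Z, inter_eq_singleton hn hm (fun e => hne (Or.inl e)) hZ hZm⟩

theorem exists_notMem {l : Set P} (hl : l ∈ 𝒜.Lines) : ∃ X, X ∉ l := by
  obtain ⟨X, Y, Z, -, -, -, h⟩ := 𝒜.exists_noncollinear
  by_contra! h'
  exact h l hl ⟨h' X, h' Y, h' Z⟩

/-- The fourth vertex of the parallelogram with sides `OI` and `OB₁` lies on neither of these lines.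
This provides a third line through `O` even in the plane of order two. -/
theorem exists_notMem_line_notMem_line {O I B₁ : P} (hOI : O ≠ I) (hB₁ : B₁ ∉ 𝒜.line O I) :
    ∃ X, X ∉ 𝒜.line O I ∧ X ∉ 𝒜.line O B₁ := by
  have hO := left_mem_line (𝒜 := 𝒜) hOI
  have hOB : O ≠ B₁ := fun e => hB₁ (e ▸ hO)
  have hl := line_mem_Lines (𝒜 := 𝒜) hOI
  have hm := line_mem_Lines (𝒜 := 𝒜) hOB
  have hne : 𝒜.line O I ≠ 𝒜.line O B₁ := fun e => hB₁ (e ▸ right_mem_line hOB)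
  obtain ⟨hn, hIn, hnm⟩ := parallelThrough_spec I hm
  obtain ⟨hk, hBk, hkl⟩ := parallelThrough_spec B₁ hl
  have hnl : 𝒜.parallelThrough I (𝒜.line O B₁) ≠ 𝒜.line O I := fun e =>
    hne (e ▸ hnm |>.eq_of_mem hO (left_mem_line hOB))
  obtain ⟨X, hX⟩ := exists_parallelThrough_inter hl hn hnl.symm (right_mem_line hOI) hIn B₁
  obtain ⟨hXk, hXn⟩ : X ∈ _ ∩ _ := hX ▸ Set.mem_singleton X
  refine ⟨X, fun h => hB₁ (hkl.eq_of_mem hXk h ▸ hBk), fun h => hne ?_⟩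
  have hI : I ∈ 𝒜.line O B₁ := hnm.eq_of_mem hXn h ▸ hIn
  exact line_eq hm hOI (left_mem_line hOB) hI

/-! ### The product and its auxiliary point -/

/-- The figure of the product `A · B = C` with auxiliary point `B₁` and first-step point `P₁`,
where the two points constructed are required to lie on the two lines cutting each other out. This
is weaker than requiring that these lines have no other common point, but equivalent to it when
`O ≠ I` and `B` is on `OI` (`ProductVia.isProduct`). -/
structure ProductVia (𝒜 : AffinePlane P) (O I A B B₁ P₁ C : P) : Prop where
  aux_notMem : B₁ ∉ 𝒜.line O I
  step_par : P₁ ∈ 𝒜.parallelThrough A (𝒜.line I B₁)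
  step_mem : P₁ ∈ 𝒜.line O B₁
  par : C ∈ 𝒜.parallelThrough P₁ (𝒜.line B B₁)
  mem : C ∈ 𝒜.line O I

theorem IsProduct.exists_productVia {O I A B C : P} (h : 𝒜.IsProduct O I A B C) :
    ∃ B₁ P₁, 𝒜.ProductVia O I A B B₁ P₁ C := by
  obtain ⟨B₁, P₁, h0, h1, h2⟩ := h
  have h1' : P₁ ∈ _ ∩ _ := h1 ▸ Set.mem_singleton P₁
  have h2' : C ∈ _ ∩ _ := h2 ▸ Set.mem_singleton C
  exact ⟨B₁, P₁, h0, h1'.1, h1'.2, h2'.1, h2'.2⟩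

section Aux

variable {O I B₁ : P} (hOI : O ≠ I) (hB₁ : B₁ ∉ 𝒜.line O I)

theorem ne_of_mem_of_notMem_line {B : P} (hB : B ∈ 𝒜.line O I) (hB₁ : B₁ ∉ 𝒜.line O I) :
    B ≠ B₁ := fun e => hB₁ (e ▸ hB)

include hOI hB₁

theorem exists_first_step (A : P) :
    ∃ P₁, 𝒜.parallelThrough A (𝒜.line I B₁) ∩ 𝒜.line O B₁ = {P₁} := by
  have hI := ne_of_mem_of_notMem_line (right_mem_line hOI) hB₁
  have hO := ne_of_mem_of_notMem_line (left_mem_line hOI) hB₁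
  refine exists_parallelThrough_inter (line_mem_Lines hI) (line_mem_Lines hO) (fun e => hB₁ ?_)
    (right_mem_line hI) (right_mem_line hO) A
  rw [line_eq (line_mem_Lines hO) hOI (left_mem_line hO) (e ▸ left_mem_line hI)]
  exact right_mem_line hO

theorem exists_second_step {B : P} (hB : B ∈ 𝒜.line O I) (P₁ : P) :
    ∃ C, 𝒜.parallelThrough P₁ (𝒜.line B B₁) ∩ 𝒜.line O I = {C} := by
  have hBB := ne_of_mem_of_notMem_line hB hB₁
  exact exists_parallelThrough_inter (line_mem_Lines hBB) (line_mem_Lines hOI)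
    (fun e => hB₁ (e ▸ right_mem_line hBB)) (left_mem_line hBB) hB P₁

theorem exists_productVia {B : P} (hB : B ∈ 𝒜.line O I) (A : P) :
    ∃ P₁ C, 𝒜.ProductVia O I A B B₁ P₁ C := by
  obtain ⟨P₁, h1⟩ := exists_first_step hOI hB₁ A
  obtain ⟨C, h2⟩ := exists_second_step hOI hB₁ hB P₁
  have h1' : P₁ ∈ _ ∩ _ := h1 ▸ Set.mem_singleton P₁
  have h2' : C ∈ _ ∩ _ := h2 ▸ Set.mem_singleton C
  exact ⟨P₁, C, hB₁, h1'.1, h1'.2, h2'.1, h2'.2⟩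

end Aux

namespace ProductVia

variable {O I A B B₁ B₂ P₁ P₂ C D : P}

theorem inter_eq_step (h : 𝒜.ProductVia O I A B B₁ P₁ C) (hOI : O ≠ I) :
    𝒜.parallelThrough A (𝒜.line I B₁) ∩ 𝒜.line O B₁ = {P₁} := by
  obtain ⟨Q, hQ⟩ := exists_first_step hOI h.aux_notMem A
  have : P₁ ∈ ({Q} : Set P) := hQ ▸ ⟨h.step_par, h.step_mem⟩
  rwa [Set.mem_singleton_iff.1 this]

theorem inter_eq_result (h : 𝒜.ProductVia O I A B B₁ P₁ C) (hOI : O ≠ I) (hB : B ∈ 𝒜.line O I) :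
    𝒜.parallelThrough P₁ (𝒜.line B B₁) ∩ 𝒜.line O I = {C} := by
  obtain ⟨Q, hQ⟩ := exists_second_step hOI h.aux_notMem hB P₁
  have : C ∈ ({Q} : Set P) := hQ ▸ ⟨h.par, h.mem⟩
  rwa [Set.mem_singleton_iff.1 this]

theorem isProduct (h : 𝒜.ProductVia O I A B B₁ P₁ C) (hOI : O ≠ I) (hB : B ∈ 𝒜.line O I) :
    𝒜.IsProduct O I A B C :=
  ⟨B₁, P₁, h.aux_notMem, h.inter_eq_step hOI, h.inter_eq_result hOI hB⟩

theorem step_unique (h : 𝒜.ProductVia O I A B B₁ P₁ C) (h' : 𝒜.ProductVia O I A D B₁ P₂ B₂)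
    (hOI : O ≠ I) : P₁ = P₂ :=
  Set.singleton_injective ((h.inter_eq_step hOI).symm.trans (h'.inter_eq_step hOI))

theorem result_unique (h : 𝒜.ProductVia O I A B B₁ P₁ C) (h' : 𝒜.ProductVia O I A B B₁ P₂ D)
    (hOI : O ≠ I) (hB : B ∈ 𝒜.line O I) : C = D := by
  obtain rfl := h.step_unique h' hOI
  exact Set.singleton_injective ((h.inter_eq_result hOI hB).symm.trans (h'.inter_eq_result hOI hB))

theorem eq_zero_of_left_eq (h : 𝒜.ProductVia O I O B B₁ P₁ C) (hOI : O ≠ I)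
    (hB : B ∈ 𝒜.line O I) : C = O := by
  have hI := ne_of_mem_of_notMem_line (right_mem_line hOI) h.aux_notMem
  have hO := ne_of_mem_of_notMem_line (left_mem_line hOI) h.aux_notMem
  have hBB := ne_of_mem_of_notMem_line hB h.aux_notMem
  exact h.result_unique (P₂ := O) ⟨h.aux_notMem, (parallelThrough_spec O (line_mem_Lines hI)).2.1,
    left_mem_line hO, (parallelThrough_spec O (line_mem_Lines hBB)).2.1, left_mem_line hOI⟩ hOI hB

theorem eq_right_of_left_eq_one (h : 𝒜.ProductVia O I I B B₁ P₁ C) (hOI : O ≠ I)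
    (hB : B ∈ 𝒜.line O I) : C = B := by
  have hI := ne_of_mem_of_notMem_line (right_mem_line hOI) h.aux_notMem
  have hO := ne_of_mem_of_notMem_line (left_mem_line hOI) h.aux_notMem
  have hBB := ne_of_mem_of_notMem_line hB h.aux_notMem
  have key : 𝒜.ProductVia O I I B B₁ B₁ B := by
    refine ⟨h.aux_notMem, ?_, right_mem_line hO, ?_, hB⟩
    · rw [parallelThrough_eq (line_mem_Lines hI) (line_mem_Lines hI) (left_mem_line hI) (.refl _)]
      exact right_mem_line hI
    · rw [parallelThrough_eq (line_mem_Lines hBB) (line_mem_Lines hBB) (right_mem_line hBB)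
        (.refl _)]
      exact left_mem_line hBB
  exact h.result_unique key hOI hB

theorem eq_zero_of_right_eq (h : 𝒜.ProductVia O I A O B₁ P₁ C) (hOI : O ≠ I) : C = O := by
  have hO := ne_of_mem_of_notMem_line (left_mem_line hOI) h.aux_notMem
  refine h.result_unique (P₂ := P₁) ⟨h.aux_notMem, h.step_par, h.step_mem, ?_, left_mem_line hOI⟩
    hOI (left_mem_line hOI)
  rw [parallelThrough_eq (line_mem_Lines hO) (line_mem_Lines hO) h.step_mem (.refl _)]
  exact left_mem_line hO

/-- The first-step point is off the line `OI`, so that it can serve as an auxiliary point. -/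
theorem step_notMem (h : 𝒜.ProductVia O I A B B₁ P₁ C) (hOI : O ≠ I) (hA : A ∈ 𝒜.line O I)
    (hAO : A ≠ O) : P₁ ∉ 𝒜.line O I := by
  intro hP
  have hI := ne_of_mem_of_notMem_line (right_mem_line hOI) h.aux_notMem
  have hO := ne_of_mem_of_notMem_line (left_mem_line hOI) h.aux_notMem
  have hPO : P₁ = O := by
    by_contra hne
    exact h.aux_notMem (eq_of_mem_of_mem (line_mem_Lines hOI) (line_mem_Lines hO) hne hP
      (left_mem_line hOI) h.step_mem (left_mem_line hO) ▸ right_mem_line hO)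
  have hp := h.step_par
  rw [hPO, mem_parallelThrough_iff hAO,
    line_eq (line_mem_Lines hOI) hAO hA (left_mem_line hOI)] at hp
  exact h.aux_notMem (hp.eq_of_mem (right_mem_line hOI) (left_mem_line hI) ▸ right_mem_line hI)

/-- A coincidence of the first-step point with the auxiliary point forces `A = I`. -/
theorem step_ne_aux (h : 𝒜.ProductVia O I A B B₁ P₁ C) (hOI : O ≠ I) (hA : A ∈ 𝒜.line O I)
    (hAI : A ≠ I) : P₁ ≠ B₁ := by
  rintro rfl
  have hI := ne_of_mem_of_notMem_line (right_mem_line hOI) h.aux_notMem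
  have hAP := ne_of_mem_of_notMem_line hA h.aux_notMem
  have hp := (mem_parallelThrough_iff hAP).1 h.step_par
  have e := hp.eq_of_mem (right_mem_line hAP) (right_mem_line hI)
  exact h.aux_notMem (eq_of_mem_of_mem (line_mem_Lines hOI) (line_mem_Lines hI) hAI hA
    (right_mem_line hOI) (e ▸ left_mem_line hAP) (left_mem_line hI) ▸ right_mem_line hI)

/-- The figure of `B · S = I`, read with the roles of auxiliary and first-step point interchanged,
is the figure of `S · B = I`. -/
theorem swap {S : P} (h : 𝒜.ProductVia O I B S B₁ P₁ I) (hOI : O ≠ I) (hB : B ∈ 𝒜.line O I)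
    (hBO : B ≠ O) (hS : S ∈ 𝒜.line O I) : 𝒜.ProductVia O I S B P₁ B₁ I := by
  have hP := h.step_notMem hOI hB hBO
  have hIB := ne_of_mem_of_notMem_line (right_mem_line hOI) h.aux_notMem
  have hOB := ne_of_mem_of_notMem_line (left_mem_line hOI) h.aux_notMem
  have hSB := ne_of_mem_of_notMem_line hS h.aux_notMem
  have hIP := ne_of_mem_of_notMem_line (right_mem_line hOI) hP
  have hOP := ne_of_mem_of_notMem_line (left_mem_line hOI) hP
  have hBP := ne_of_mem_of_notMem_line hB hP
  refine ⟨hP, ?_, ?_, ?_, right_mem_line hOI⟩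
  · rw [mem_parallelThrough_iff hSB, line_comm I P₁]
    exact ((mem_parallelThrough_iff hIP.symm).1 h.par).symm
  · rw [line_eq (line_mem_Lines hOB) hOP (left_mem_line hOB) h.step_mem]
    exact right_mem_line hOB
  · rw [mem_parallelThrough_comm, mem_parallelThrough_iff hIB]
    exact ((mem_parallelThrough_iff hBP).1 h.step_par).symm

/-- Desargues' axiom, used twice, shows that auxiliary points on different lines through `O` yield
the same product. The excluded values of `A` and `B` are those for which the figure degenerates. -/
theorem result_par_of_desargues (h𝒜 : 𝒜.Desargues) (h : 𝒜.ProductVia O I A B B₁ P₁ C)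
    (h' : 𝒜.ProductVia O I A B B₂ P₂ D) (hOI : O ≠ I) (hA : A ∈ 𝒜.line O I)
    (hB : B ∈ 𝒜.line O I) (hAO : A ≠ O) (hAI : A ≠ I) (hBO : B ≠ O)
    (hB₂ : B₂ ∉ 𝒜.line O B₁) : C ∈ 𝒜.parallelThrough P₂ (𝒜.line B B₂) := by
  have hl := line_mem_Lines (𝒜 := 𝒜) hOI
  have hOl := left_mem_line (𝒜 := 𝒜) hOI
  have hIl := right_mem_line (𝒜 := 𝒜) hOI
  have h1 := h.aux_notMem
  have h2 := h'.aux_notMem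
  have hP1 := h.step_notMem hOI hA hAO
  have hP2 := h'.step_notMem hOI hA hAO
  have hPB1 := h.step_ne_aux hOI hA hAI
  have hPB2 := h'.step_ne_aux hOI hA hAI
  have hOB1 := ne_of_mem_of_notMem_line hOl h1
  have hOB2 := ne_of_mem_of_notMem_line hOl h2
  have hIB1 := ne_of_mem_of_notMem_line hIl h1
  have hIB2 := ne_of_mem_of_notMem_line hIl h2
  have hBB1 := ne_of_mem_of_notMem_line hB h1
  have hBB2 := ne_of_mem_of_notMem_line hB h2
  have hAP1 := ne_of_mem_of_notMem_line hA hP1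
  have hAP2 := ne_of_mem_of_notMem_line hA hP2
  have hCP1 := ne_of_mem_of_notMem_line h.mem hP1
  have hCP2 := ne_of_mem_of_notMem_line h.mem hP2
  have hm1 := line_mem_Lines (𝒜 := 𝒜) hOB1
  have hm2 := line_mem_Lines (𝒜 := 𝒜) hOB2
  have e1 : 𝒜.line B₁ P₁ = 𝒜.line O B₁ := line_eq hm1 hPB1.symm (right_mem_line hOB1) h.step_mem
  have e2 : 𝒜.line B₂ P₂ = 𝒜.line O B₂ := line_eq hm2 hPB2.symm (right_mem_line hOB2) h'.step_mem
  have eIA : 𝒜.line I A = 𝒜.line O I := line_eq hl hAI.symm hIl hA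
  have n01 : 𝒜.line O I ≠ 𝒜.line O B₁ := fun e => h1 (e ▸ right_mem_line hOB1)
  have n02 : 𝒜.line O I ≠ 𝒜.line O B₂ := fun e => h2 (e ▸ right_mem_line hOB2)
  have n12 : 𝒜.line O B₁ ≠ 𝒜.line O B₂ := fun e => hB₂ (e ▸ right_mem_line hOB2)
  -- A point other than `O` on one of the three lines through `O` is not on the others.
  have off : ∀ {m n : Set P}, m ∈ 𝒜.Lines → n ∈ 𝒜.Lines → m ≠ n → O ∈ m → O ∈ n →
      ∀ {X : P}, X ∈ m → X ≠ O → X ∉ n := fun hm hn hmn hOm hOn X hXm hXO hXn =>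
    hmn (eq_of_mem_of_mem hm hn hXO hXm hOm hXn hOn)
  have hOm1 := left_mem_line (𝒜 := 𝒜) hOB1
  have hOm2 := left_mem_line (𝒜 := 𝒜) hOB2
  have hP1O := (ne_of_mem_of_notMem_line hOl hP1).symm
  have hP2O := (ne_of_mem_of_notMem_line hOl hP2).symm
  have hP2m1 : P₂ ∉ 𝒜.line O B₁ := off hm2 hm1 n12.symm hOm2 hOm1 h'.step_mem hP2O
  have hP1m2 : P₁ ∉ 𝒜.line O B₂ := off hm1 hm2 n12 hOm1 hOm2 h.step_mem hP1O
  have hB1m2 : B₁ ∉ 𝒜.line O B₂ := off hm1 hm2 n12 hOm1 hOm2 (right_mem_line hOB1) hOB1.symm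
  have hBm1 : B ∉ 𝒜.line O B₁ := off hl hm1 n01 hOl hOm1 hB hBO
  have hBm2 : B ∉ 𝒜.line O B₂ := off hl hm2 n02 hOl hOm2 hB hBO
  have hB12 : B₁ ≠ B₂ := fun e => hB₂ (e ▸ right_mem_line hOB1)
  have hP12 : P₁ ≠ P₂ := fun e => hP2m1 (e ▸ h.step_mem)
  have pA1 := (mem_parallelThrough_iff hAP1).1 h.step_par
  have pA2 := (mem_parallelThrough_iff hAP2).1 h'.step_par
  have pC1 := (mem_parallelThrough_iff hCP1.symm).1 h.par
  -- `IB₁ ≠ AP₁` and `IB₂ ≠ AP₂`, as otherwise these lines would be `OI`.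
  have nIA : ∀ {X Y : P}, X ∉ 𝒜.line O I → A ≠ Y → I ≠ X → 𝒜.line I X ≠ 𝒜.line A Y := by
    intro X Y hX hAY hIX e
    exact hX (eq_of_mem_of_mem hl (line_mem_Lines hIX) hAI hA hIl (e ▸ left_mem_line hAY)
      (left_mem_line hIX) ▸ right_mem_line hIX)
  have conc : ∀ {X : P}, X ∈ 𝒜.line O B₁ ∩ 𝒜.line O I ∩ 𝒜.line O B₂ → X = O := fun hX => by
    by_contra hXO
    exact off hm1 hl n01.symm hOm1 hOl hX.1.1 hXO hX.1.2
  have nB1P1 : 𝒜.line B₁ B₂ ≠ 𝒜.line P₁ P₂ := fun e => hB₂ <|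
    eq_of_mem_of_mem (line_mem_Lines hB12) hm1 hPB1 (e ▸ left_mem_line hP12) (left_mem_line hB12)
      h.step_mem (right_mem_line hOB1) ▸ right_mem_line hB12
  -- First application, to the triangles `B₁ I B₂` and `P₁ A P₂`.
  have par12 : Parallel (𝒜.line B₁ B₂) (𝒜.line P₁ P₂) := by
    refine h𝒜 B₁ I B₂ P₁ A P₂ hPB1.symm hAI.symm hPB2.symm hIB1.symm hAP1.symm hIB2 hAP2 hB12 hP12
      ?_ ?_ (nIA h2 hAP2 hIB2) (Or.inr ⟨O, ?_⟩) ?_ pA2.symm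
    · rw [e1, e2, eIA]
      simp only [List.nodup_cons, List.mem_cons, List.not_mem_nil, or_false, not_or,
        not_false_eq_true, List.nodup_nil, and_true]
      exact ⟨⟨n01.symm, n12, fun e => hB₂ (e ▸ right_mem_line hB12),
        fun e => hP2m1 (e ▸ right_mem_line hP12)⟩, ⟨n02, fun e => h1 (e ▸ left_mem_line hB12),
        fun e => hP1 (e ▸ left_mem_line hP12)⟩, ⟨fun e => hB1m2 (e ▸ left_mem_line hB12),
        fun e => hP1m2 (e ▸ left_mem_line hP12)⟩, nB1P1⟩
    · rw [line_comm B₁, line_comm P₁]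
      exact nIA h1 hAP1 hIB1
    · rw [e1, e2, eIA]
      exact Set.eq_singleton_iff_unique_mem.2 ⟨⟨⟨hOm1, hOl⟩, hOm2⟩, fun X hX => conc hX⟩
    · rw [line_comm B₁, line_comm P₁]
      exact pA1.symm
  rw [mem_parallelThrough_iff hCP2.symm, line_comm P₂]
  -- Second application, to the triangles `B B₁ B₂` and `C P₁ P₂`.
  have nBB1 : 𝒜.line B B₁ ≠ 𝒜.line C P₁ := fun e => hBm1 <|
    eq_of_mem_of_mem (line_mem_Lines hBB1) hm1 hPB1 (e ▸ right_mem_line hCP1)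
      (right_mem_line hBB1) h.step_mem (right_mem_line hOB1) ▸ left_mem_line hBB1
  rw [line_comm P₁] at pC1
  have hBC : B ≠ C := by
    rintro rfl
    exact nBB1 (pC1.eq_of_mem (left_mem_line hCP1) (left_mem_line hBB1)).symm
  have hCO : C ≠ O := by
    rintro rfl
    rw [line_eq hm1 hCP1 hOm1 h.step_mem] at pC1
    exact hBm1 (pC1.eq_of_mem (right_mem_line hOB1) (right_mem_line hBB1) ▸ left_mem_line hBB1)
  have hCm2 : C ∉ 𝒜.line O B₂ := off hl hm2 n02 hOl hOm2 h.mem hCO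
  have eBC : 𝒜.line B C = 𝒜.line O I := line_eq hl hBC hB h.mem
  by_cases hEq : 𝒜.line B B₂ = 𝒜.line C P₂
  · exact Or.inl hEq.symm
  refine (h𝒜 B B₁ B₂ C P₁ P₂ hBC hPB1.symm hPB2.symm hBB1 hCP1 hB12 hP12 hBB2 hCP2
      ?_ nBB1 nB1P1 (Or.inr ⟨O, ?_⟩) pC1.symm par12).symm
  · rw [e1, e2, eBC]
    simp only [List.nodup_cons, List.mem_cons, List.not_mem_nil, or_false, not_or,
      not_false_eq_true, List.nodup_nil, and_true]
    exact ⟨⟨n01, n02, fun e => h2 (e ▸ right_mem_line hBB2), fun e => hP2 (e ▸ right_mem_line hCP2)⟩,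
      ⟨n12, fun e => hBm1 (e ▸ left_mem_line hBB2), fun e => hP2m1 (e ▸ right_mem_line hCP2)⟩,
      ⟨fun e => hBm2 (e ▸ left_mem_line hBB2), fun e => hCm2 (e ▸ left_mem_line hCP2)⟩, hEq⟩
  · rw [e1, e2, eBC]
    exact Set.eq_singleton_iff_unique_mem.2
      ⟨⟨⟨hOl, hOm1⟩, hOm2⟩, fun X hX => conc ⟨⟨hX.1.2, hX.1.1⟩, hX.2⟩⟩

theorem result_eq_of_notMem_line (h𝒜 : 𝒜.Desargues) (h : 𝒜.ProductVia O I A B B₁ P₁ C)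
    (h' : 𝒜.ProductVia O I A B B₂ P₂ D) (hOI : O ≠ I) (hA : A ∈ 𝒜.line O I)
    (hB : B ∈ 𝒜.line O I) (hB₂ : B₂ ∉ 𝒜.line O B₁) : C = D := by
  rcases eq_or_ne A O with rfl | hAO
  · rw [h.eq_zero_of_left_eq hOI hB, h'.eq_zero_of_left_eq hOI hB]
  rcases eq_or_ne A I with rfl | hAI
  · rw [h.eq_right_of_left_eq_one hOI hB, h'.eq_right_of_left_eq_one hOI hB]
  rcases eq_or_ne B O with rfl | hBO
  · rw [h.eq_zero_of_right_eq hOI, h'.eq_zero_of_right_eq hOI]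
  · exact result_unique ⟨h'.aux_notMem, h'.step_par, h'.step_mem,
      h.result_par_of_desargues h𝒜 h' hOI hA hB hAO hAI hBO hB₂, h.mem⟩ h' hOI hB

/-- The product does not depend on the auxiliary point. -/
theorem result_eq (h𝒜 : 𝒜.Desargues) (h : 𝒜.ProductVia O I A B B₁ P₁ C)
    (h' : 𝒜.ProductVia O I A B B₂ P₂ D) (hOI : O ≠ I) (hA : A ∈ 𝒜.line O I)
    (hB : B ∈ 𝒜.line O I) : C = D := by
  by_cases hB₂ : B₂ ∈ 𝒜.line O B₁
  · obtain ⟨B₃, h3, h31⟩ := exists_notMem_line_notMem_line hOI h.aux_notMem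
    obtain ⟨P₃, E, hE⟩ := exists_productVia hOI h3 hB A
    have hOB1 := ne_of_mem_of_notMem_line (left_mem_line hOI) h.aux_notMem
    have hOB2 := ne_of_mem_of_notMem_line (left_mem_line hOI) h'.aux_notMem
    have e : 𝒜.line O B₂ = 𝒜.line O B₁ :=
      line_eq (line_mem_Lines hOB1) hOB2 (left_mem_line hOB1) hB₂
    exact (h.result_eq_of_notMem_line h𝒜 hE hOI hA hB h31).trans
      (h'.result_eq_of_notMem_line h𝒜 hE hOI hA hB (e ▸ h31)).symm
  · exact h.result_eq_of_notMem_line h𝒜 h' hOI hA hB hB₂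

/-- Every point off `OI` can be used as the auxiliary point of a given product. -/
theorem of_isProduct (h𝒜 : 𝒜.Desargues) (h : 𝒜.IsProduct O I A B C) (hOI : O ≠ I)
    (hA : A ∈ 𝒜.line O I) (hB : B ∈ 𝒜.line O I) (hB₁ : B₁ ∉ 𝒜.line O I) :
    ∃ P₁, 𝒜.ProductVia O I A B B₁ P₁ C := by
  obtain ⟨B₂, P₂, h2⟩ := h.exists_productVia
  obtain ⟨P₁, D, h1⟩ := exists_productVia hOI hB₁ hB A
  obtain rfl := h1.result_eq h𝒜 h2 hOI hA hB
  exact ⟨P₁, h1⟩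

end ProductVia

variable {O I A B : P}

theorem existsUnique_isProduct (h𝒜 : 𝒜.Desargues) (hOI : O ≠ I) (hA : A ∈ 𝒜.line O I)
    (hB : B ∈ 𝒜.line O I) : ∃! C, 𝒜.IsProduct O I A B C := by
  obtain ⟨B₁, hB₁⟩ := exists_notMem (line_mem_Lines (𝒜 := 𝒜) hOI)
  obtain ⟨P₁, C, h⟩ := exists_productVia hOI hB₁ hB A
  refine ⟨C, h.isProduct hOI hB, fun D hD => ?_⟩
  obtain ⟨B₂, P₂, h'⟩ := hD.exists_productVia
  exact h'.result_eq h𝒜 h hOI hA hB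

/-! ### Inverses -/

theorem existsUnique_isInverse (h𝒜 : 𝒜.Desargues) (hOI : O ≠ I) (hB : B ∈ 𝒜.line O I)
    (hBO : B ≠ O) : ∃! S, 𝒜.IsInverse O I B S := by
  have hl := line_mem_Lines (𝒜 := 𝒜) hOI
  have hI := right_mem_line (𝒜 := 𝒜) hOI
  obtain ⟨B₁, hB₁⟩ := exists_notMem hl
  obtain ⟨P₁, _, h⟩ := exists_productVia hOI hB₁ hI B
  have hP₁ := h.step_notMem hOI hB hBO
  have hIP := ne_of_mem_of_notMem_line hI hP₁
  -- The inverse is cut out on `OI` by the line through `B₁` parallel to `IP₁`.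
  obtain ⟨S, hS⟩ := exists_second_step hOI hP₁ hI B₁
  obtain ⟨hSp, hSl⟩ : S ∈ _ ∩ _ := hS ▸ Set.mem_singleton S
  have hSB := ne_of_mem_of_notMem_line hSl hB₁
  have hv : 𝒜.ProductVia O I B S B₁ P₁ I := by
    refine ⟨hB₁, h.step_par, h.step_mem, ?_, hI⟩
    rw [mem_parallelThrough_iff hIP.symm, line_comm P₁, line_comm S]
    exact ((mem_parallelThrough_iff hSB.symm).1 hSp).symm
  refine ⟨S, ⟨hSl, hv.isProduct hOI hSl, (hv.swap hOI hB hBO hSl).isProduct hOI hB⟩, ?_⟩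
  rintro T ⟨hTl, hT, -⟩
  obtain ⟨Q, hQ⟩ := ProductVia.of_isProduct h𝒜 hT hOI hB hTl hB₁
  obtain rfl := h.step_unique hQ hOI
  have hT' := mem_parallelThrough_comm.1 (hQ.swap hOI hB hBO hTl).step_par
  have hTS := Set.mem_inter hT' hTl
  rwa [hS, Set.mem_singleton_iff] at hTS

theorem isInverse_inv (h𝒜 : 𝒜.Desargues) (hOI : O ≠ I) (hB : B ∈ 𝒜.line O I) (hBO : B ≠ O) :
    𝒜.IsInverse O I B (𝒜.inv O I B) :=
  Classical.epsilon_spec_aux _ _ (existsUnique_isInverse h𝒜 hOI hB hBO).exists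

theorem isProduct_mul (h𝒜 : 𝒜.Desargues) (hOI : O ≠ I) (hA : A ∈ 𝒜.line O I)
    (hB : B ∈ 𝒜.line O I) : 𝒜.IsProduct O I A B (𝒜.mul O I A B) :=
  Classical.epsilon_spec_aux _ _ (existsUnique_isProduct h𝒜 hOI hA hB).exists

/-! ### Collineations -/

namespace IsCollineation

variable {f : Equiv.Perm P}

theorem image_line (hf : 𝒜.IsCollineation f) {X Y : P} (hXY : X ≠ Y) :
    f '' 𝒜.line X Y = 𝒜.line (f X) (f Y) :=
  (line_eq ((hf _).1 (line_mem_Lines hXY)) (f.injective.ne hXY)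
    (Set.mem_image_of_mem f (left_mem_line hXY))
    (Set.mem_image_of_mem f (right_mem_line hXY))).symm

theorem image_parallelThrough (hf : 𝒜.IsCollineation f) {l : Set P} (hl : l ∈ 𝒜.Lines) (X : P) :
    f '' 𝒜.parallelThrough X l = 𝒜.parallelThrough (f X) (f '' l) := by
  obtain ⟨hm, hX, h⟩ := parallelThrough_spec X hl
  refine (parallelThrough_eq ((hf _).1 hl) ((hf _).1 hm) (Set.mem_image_of_mem f hX) ?_).symm
  exact h.imp (congrArg _) fun h => by rw [← Set.image_inter f.injective, h, Set.image_empty]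

theorem map_isProduct (hf : 𝒜.IsCollineation f) {C : P} (hOI : O ≠ I) (hB : B ∈ 𝒜.line O I)
    (h : 𝒜.IsProduct O I A B C) : 𝒜.IsProduct (f O) (f I) (f A) (f B) (f C) := by
  obtain ⟨B₁, P₁, h0, h1, h2⟩ := h
  have hIB := ne_of_mem_of_notMem_line (right_mem_line hOI) h0
  have hOB := ne_of_mem_of_notMem_line (left_mem_line hOI) h0
  have hBB := ne_of_mem_of_notMem_line hB h0
  refine ⟨f B₁, f P₁, ?_, ?_, ?_⟩
  · rwa [← hf.image_line hOI, f.injective.mem_set_image]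
  · rw [← hf.image_line hIB, ← hf.image_line hOB, ← hf.image_parallelThrough (line_mem_Lines hIB),
      ← Set.image_inter f.injective, h1, Set.image_singleton]
  · rw [← hf.image_line hBB, ← hf.image_line hOI, ← hf.image_parallelThrough (line_mem_Lines hBB),
      ← Set.image_inter f.injective, h2, Set.image_singleton]

theorem map_isInverse (hf : 𝒜.IsCollineation f) {S : P} (hOI : O ≠ I) (hB : B ∈ 𝒜.line O I)
    (h : 𝒜.IsInverse O I B S) : 𝒜.IsInverse (f O) (f I) (f B) (f S) :=
  ⟨hf.image_line hOI ▸ Set.mem_image_of_mem f h.1, hf.map_isProduct hOI h.1 h.2.1,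
    hf.map_isProduct hOI hB h.2.2⟩

end IsCollineation

theorem IsTranslation.isCollineation {f : Equiv.Perm P} (hf : 𝒜.IsTranslation f) :
    𝒜.IsCollineation f := by
  rcases hf with rfl | hf
  · intro l
    simp
  · exact hf.1.1

end AffinePlane

open AffinePlane in
theorem mainTheorem6 {P : Type*} (𝒜 : AffinePlane P) (h𝒜 : 𝒜.Desargues)
    (φ : Equiv.Perm P) (hφ : 𝒜.IsTranslation φ)
    (O I A B : P) (hOI : O ≠ I) (hA : A ∈ 𝒜.line O I) (hB : B ∈ 𝒜.line O I) (hBO : B ≠ O) :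
    (∃! S : P, 𝒜.IsInverse O I B S) ∧
    (∃! R : P, 𝒜.IsProduct O I (𝒜.inv O I B) A R) ∧
    φ (𝒜.inv O I B) = 𝒜.inv (φ O) (φ I) (φ B) ∧
    φ (𝒜.ratio O I A B) = 𝒜.ratio (φ O) (φ I) (φ A) (φ B) := by
  have hf := hφ.isCollineation
  have hinv := isInverse_inv h𝒜 hOI hB hBO
  have hOI' : φ O ≠ φ I := φ.injective.ne hOI
  have hmem : ∀ {X : P}, X ∈ 𝒜.line O I → φ X ∈ 𝒜.line (φ O) (φ I) := fun hX =>
    hf.image_line hOI ▸ Set.mem_image_of_mem φ hX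
  have hBO' : φ B ≠ φ O := φ.injective.ne hBO
  have hφinv : φ (𝒜.inv O I B) = 𝒜.inv (φ O) (φ I) (φ B) :=
    (existsUnique_isInverse h𝒜 hOI' (hmem hB) hBO').unique (hf.map_isInverse hOI hB hinv)
      (isInverse_inv h𝒜 hOI' (hmem hB) hBO')
  refine ⟨existsUnique_isInverse h𝒜 hOI hB hBO, existsUnique_isProduct h𝒜 hOI hinv.1 hA,
    hφinv, ?_⟩
  rw [ratio, ratio, ← hφinv]
  exact (existsUnique_isProduct h𝒜 hOI' (hmem hinv.1) (hmem hA)).unique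
    (hf.map_isProduct hOI hA (isProduct_mul h𝒜 hOI hinv.1 hA))
    (isProduct_mul h𝒜 hOI' (hmem hinv.1) (hmem hA))
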